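/- **Theorem 3.1.** Let $k\ge 2$ be an integer and let $\alpha>0$, $0<p<1$, $r>0$ be real constants. For each $n$ let $d=d_n$, $q=q_n$, $t=t_n$ be non-negative integers obtained from $n^{\alpha}$, $p\,d^{k}$, $r\,n\ln d$, respectively, by rounding up or down in an arbitrary way (that is, $|d-n^\alpha|<1$, $|q-p\,d^k|<1$ and $|t-r\,n\ln d|<1$). A random instance of Model RB has $n$ variables, each with a domain of $d$ values, and $t$ constraints chosen independently (with repetition); each constraint consists of a uniformly random set of $k$ distinct variables and, independently, a uniformly random set of $q$ of the $d^k$ tuples of values for these variables, which are declared incompatible. A solution is an assignment of values to all $n$ variables for which, in every constraint, the tuple of values assigned to its $k$ variables is not incompatible. Let $X$ be the number of solutions of the random instance. Put $\tau=\frac1{1-p}$ and $r_{cr}=\frac1{\ln\tau}$, and assume $$(2k-1)\alpha>1\qquad\text{and}\qquad k\ge\frac{\tau\ln\tau}{\tau-1}.$$ Then $$\lim_{n\to\infty}\Pr[X>0]=1\ \text{ if } r<r_{cr},\qquad \lim_{n\to\infty}\Pr[X>0]=0\ \text{ if } r>r_{cr}.$$ -/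

import Mathlib

open Filter Topology

/-- A constraint of Model RB on the variables `Fin n`, each with domain `Fin d`: a set of exactly `k`
distinct variables (the scope) together with a set of exactly `q` incompatible tuples of values. A
tuple lists the values of the variables of the scope in increasing order of the variables. -/
abbrev RBConstraint (n d k q : ℕ) : Type :=
  {s : Finset (Fin n) // s.card = k} × {Q : Finset (Fin k → Fin d) // Q.card = q}

/-- The assignment `a` satisfies the constraint `c`: the tuple of values that `a` gives to the
variables of the scope is not one of the incompatible tuples. -/
def RBConstraint.IsSatisfiedBy {n d k q : ℕ} (c : RBConstraint n d k q) (a : Fin n → Fin d) : Prop :=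
  (fun j : Fin k => a (c.1.1.orderEmbOfFin c.1.2 j)) ∉ c.2.1

/-- An instance of Model RB: a sequence of `t` constraints (repetitions allowed). -/
def RBInstance (n d k q t : ℕ) : Type := Fin t → RBConstraint n d k q

/-- A solution is an assignment to all variables that satisfies all the constraints. -/
def RBInstance.IsSolution {n d k q t : ℕ} (I : RBInstance n d k q t) (a : Fin n → Fin d) : Prop :=
  ∀ i : Fin t, (I i).IsSatisfiedBy a

/-- The number `X` of solutions of an instance. -/
noncomputable def RBInstance.numSolutions {n d k q t : ℕ} (I : RBInstance n d k q t) : ℕ :=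
  Nat.card {a : Fin n → Fin d // I.IsSolution a}

/-- Every set of instances is an event. -/
instance (n d k q t : ℕ) : MeasurableSpace (RBInstance n d k q t) := ⊤

/-- The law of a random instance: the uniform distribution on the finite set of all instances.
Equivalently, the `t` constraints are independent, and in each of them the scope is uniform among the
`k`-sets of variables and, independently, the set of incompatible tuples is uniform among the `q`-sets
of tuples. -/
noncomputable def rbLaw (n d k q t : ℕ) : MeasureTheory.Measure (RBInstance n d k q t) :=
  ProbabilityTheory.uniformOn Set.univ

/-- The probability that a random instance of Model RB is satisfiable, `Pr[X > 0]`. -/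
noncomputable def rbProbSat (n d k q t : ℕ) : ℝ :=
  (rbLaw n d k q t).real {I | 0 < I.numSolutions}

/-!
The proof is by the second moment method. Let `x = 1 / d`, `N = d ^ k`. The mean of the number `X`
of solutions is `d ^ n * (1 - q / N) ^ t = exp (n log d * (1 - r / r_cr + o(1)))`; for `r > r_cr` it
tends to `0`, and so does `Pr[X > 0] ≤ E X` (`tendsto_rbProbSat_zero`).

For `r < r_cr`, Cauchy-Schwarz gives `Pr[X > 0] ≥ (E X)² / E X²`. Grouping pairs of assignments by
the number `s` of variables on which they agree, which is binomial with parameters `n` and `x`, gives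
the exact formula
`E X² / (E X)² = E_s [(1 + C * (C(s,k) / C(n,k) - 1 / N)) ^ t]`, `C → p / (1 - p) = τ - 1`
(`momentRatio`, `one_le_rbProbSat_mul_momentRatio`), and it remains to show that the right side is at
most `1 + o(1)`. The term `- 1 / N` records that the forbidden tuples are drawn without
replacement, and `1 / N` is exactly the mean of `C(s,k) / C(n,k)`. Because of this cancellation only
the fluctuation of `s` around `n / d` matters, which has order `(n / d) ^ (1/2)`. With
`C(s,k) / C(n,k) ≤ (s / n) ^ k`, its effect on the exponent is of order
`n log d * d ^ (-(k - 1)) * (n d) ^ (-1/2)` up to small powers of `d`, and this tends to `0` exactly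
because `(2k - 1) α > 1`.

This treats `s / n ≤ d ^ (-(1 - δ))` (`sum_binomial_mul_exp_max_le`). For larger `s` the estimate
`C(n,s) ≤ (e n / s) ^ s` is used. If `s / n ≤ d ^ (-δ)`, the factor `(...) ^ t` is at most `e ^ s`.
If `s / n ≥ d ^ (-δ)`, the condition on `k` yields `1 + (τ - 1) σ ^ k ≤ τ ^ σ` for `0 ≤ σ ≤ 1`
(`one_add_mul_pow_le_exp`), so that, as `r log τ < 1 - 2 δ`, the factor is at most
`d ^ ((1 - 2 δ) s)`. In both ranges the `s`-th term is at most `(e² d ^ (-δ)) ^ s`, and these sum to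
`o(1)` (`momentRatio_le`, `tendsto_momentRatio_le`).
-/

/-! ### Counting constraints satisfied by two assignments -/

/-- The set of variables on which two assignments agree. -/
def agreeSet {n d : ℕ} (a b : Fin n → Fin d) : Finset (Fin n) :=
  Finset.univ.filter fun i => a i = b i

/-- The number of constraints satisfied by both of the assignments `a` and `b`. -/
noncomputable def jointCount {n d : ℕ} (k q : ℕ) (a b : Fin n → Fin d) : ℕ :=
  Nat.card {c : RBConstraint n d k q // c.IsSatisfiedBy a ∧ c.IsSatisfiedBy b}

theorem card_disjoint_subsets {T : Type*} [Fintype T] [DecidableEq T] (q : ℕ) (S : Finset T) :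
    Nat.card {Q : {Q : Finset T // Q.card = q} // Disjoint Q.1 S} =
      (Fintype.card T - S.card).choose q := by
  rw [← Finset.card_compl, ← Finset.card_powersetCard, ← Nat.card_eq_finsetCard]
  refine Nat.card_congr ((Equiv.subtypeSubtypeEquivSubtypeInter (fun Q : Finset T => Q.card = q)
    (fun Q => Disjoint Q S)).trans
      (Equiv.subtypeEquivRight (q := fun Q => Q ∈ Finset.powersetCard q Sᶜ) fun Q => ?_))
  rw [Finset.mem_powersetCard, Finset.subset_compl_iff_disjoint_right, and_comm]

theorem card_scopes_subset {n k : ℕ} (A : Finset (Fin n)) :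
    (Finset.univ.filter fun s : {s : Finset (Fin n) // s.card = k} => s.1 ⊆ A).card =
      A.card.choose k := by
  rw [← Finset.card_powersetCard]
  refine Finset.card_bij (fun s _ => s.1) ?_ ?_ ?_
  · intro s hs
    simpa [Finset.mem_powersetCard, s.2] using hs
  · intro s _ s' _ h
    exact Subtype.ext h
  · intro s hs
    rw [Finset.mem_powersetCard] at hs
    exact ⟨⟨s, hs.2⟩, by simpa using hs.1, rfl⟩

theorem tuple_eq_iff_subset_agreeSet {n d k : ℕ} (a b : Fin n → Fin d)
    (s : {s : Finset (Fin n) // s.card = k}) :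
    ((fun j : Fin k => a (s.1.orderEmbOfFin s.2 j)) = fun j => b (s.1.orderEmbOfFin s.2 j)) ↔
      s.1 ⊆ agreeSet a b := by
  have h := Finset.range_orderEmbOfFin s.1 s.2
  constructor
  · intro he i hi
    have : i ∈ Set.range (s.1.orderEmbOfFin s.2) := by rw [h]; exact hi
    obtain ⟨j, rfl⟩ := this
    simpa [agreeSet] using congrFun he j
  · intro hs
    funext j
    simpa [agreeSet] using hs (Finset.orderEmbOfFin_mem s.1 s.2 j)

theorem jointCount_eq {n d : ℕ} (k q : ℕ) (a b : Fin n → Fin d) :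
    jointCount k q a b =
      (agreeSet a b).card.choose k * (d ^ k - 1).choose q +
        (n.choose k - (agreeSet a b).card.choose k) * (d ^ k - 2).choose q := by
  classical
  have hT : Fintype.card (Fin k → Fin d) = d ^ k := by simp
  have key : ∀ s : {s : Finset (Fin n) // s.card = k},
      Nat.card {Q : {Q : Finset (Fin k → Fin d) // Q.card = q} //
        RBConstraint.IsSatisfiedBy (s, Q) a ∧ RBConstraint.IsSatisfiedBy (s, Q) b} =
      if s.1 ⊆ agreeSet a b then (d ^ k - 1).choose q else (d ^ k - 2).choose q := by
    intro s
    set u := fun j : Fin k => a (s.1.orderEmbOfFin s.2 j)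
    set v := fun j : Fin k => b (s.1.orderEmbOfFin s.2 j)
    have h1 : Nat.card {Q : {Q : Finset (Fin k → Fin d) // Q.card = q} //
        RBConstraint.IsSatisfiedBy (s, Q) a ∧ RBConstraint.IsSatisfiedBy (s, Q) b} =
        Nat.card {Q : {Q : Finset (Fin k → Fin d) // Q.card = q} // Disjoint Q.1 {u, v}} := by
      refine Nat.card_congr (Equiv.subtypeEquivRight fun Q => ?_)
      simp [RBConstraint.IsSatisfiedBy, u, v]
    rw [h1, card_disjoint_subsets, hT]
    by_cases h : u = v
    · rw [if_pos ((tuple_eq_iff_subset_agreeSet a b s).1 h), h]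
      simp
    · rw [if_neg (fun hs => h ((tuple_eq_iff_subset_agreeSet a b s).2 hs)), Finset.card_pair h]
  unfold jointCount
  rw [Nat.card_congr (Equiv.subtypeProdEquivSigmaSubtype
    fun (s : {s : Finset (Fin n) // s.card = k}) (Q : {Q : Finset (Fin k → Fin d) // Q.card = q}) =>
      RBConstraint.IsSatisfiedBy (s, Q) a ∧ RBConstraint.IsSatisfiedBy (s, Q) b), Nat.card_sigma,
    Finset.sum_congr rfl fun s _ => key s, Finset.sum_ite, Finset.sum_const, Finset.sum_const,
    smul_eq_mul, smul_eq_mul, card_scopes_subset, Finset.filter_not,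
    Finset.card_sdiff_of_subset (Finset.filter_subset _ _), card_scopes_subset]
  simp

theorem card_agreeSet_eq {n d : ℕ} (a : Fin n → Fin d) (A : Finset (Fin n)) :
    (Finset.univ.filter fun b : Fin n → Fin d => agreeSet a b = A).card =
      (d - 1) ^ (n - A.card) := by
  classical
  have : (Finset.univ.filter fun b : Fin n → Fin d => agreeSet a b = A) =
      Fintype.piFinset fun i => if i ∈ A then {a i} else Finset.univ.erase (a i) := by
    ext b
    simp only [Finset.mem_filter, Finset.mem_univ, true_and, Fintype.mem_piFinset,
      Finset.ext_iff, agreeSet]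
    refine forall_congr' fun i => ?_
    by_cases h : i ∈ A <;> simp [h, eq_comm]
  rw [this, Fintype.card_piFinset]
  have : ∀ i, (if i ∈ A then {a i} else Finset.univ.erase (a i) : Finset (Fin d)).card =
      if i ∈ A then 1 else d - 1 := by
    intro i
    split_ifs <;> simp
  simp_rw [this]
  rw [Finset.prod_ite]
  simp [Finset.filter_not, Finset.card_sdiff_of_subset]

/-- Among all assignments `b`, the size of the agreement with a fixed `a` is distributed, up to
normalisation, like a binomial variable with parameters `n` and `1 / d`. -/
theorem sum_agreeSet_card {n d : ℕ} (a : Fin n → Fin d) (F : ℕ → ℝ) :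
    ∑ b : Fin n → Fin d, F (agreeSet a b).card =
      ∑ s ∈ Finset.range (n + 1), (n.choose s : ℝ) * ((d - 1 : ℕ) : ℝ) ^ (n - s) * F s := by
  classical
  have h := Finset.sum_powerset_apply_card
    (fun s => ((d - 1 : ℕ) : ℝ) ^ (n - s) * F s) (x := (Finset.univ : Finset (Fin n)))
  rw [Finset.card_univ, Fintype.card_fin] at h
  simp_rw [nsmul_eq_mul, ← mul_assoc] at h
  rw [← h, Finset.powerset_univ,
    ← Finset.sum_fiberwise_of_maps_to (s := Finset.univ) (t := Finset.univ)
      (g := fun b => agreeSet a b) (fun _ _ => Finset.mem_univ _)]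
  refine Finset.sum_congr rfl fun A _ => ?_
  rw [Finset.sum_congr rfl (g := fun _ => F A.card)
    (fun b hb => by rw [(Finset.mem_filter.1 hb).2]), Finset.sum_const, card_agreeSet_eq]
  simp

/-! ### First and second moments of the number of solutions -/

instance (n d k q t : ℕ) : Fintype (RBInstance n d k q t) :=
  inferInstanceAs (Fintype (Fin t → RBConstraint n d k q))

theorem card_rbInstance (n d k q t : ℕ) :
    Fintype.card (RBInstance n d k q t) = (n.choose k * (d ^ k).choose q) ^ t := by
  have : Fintype.card (RBInstance n d k q t) = Fintype.card (Fin t → RBConstraint n d k q) := rfl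
  rw [this]
  simp [RBConstraint]

theorem card_common_solution {n d k q t : ℕ} (a b : Fin n → Fin d) :
    Nat.card {I : RBInstance n d k q t // I.IsSolution a ∧ I.IsSolution b} =
      jointCount k q a b ^ t := by
  have e : {I : RBInstance n d k q t // I.IsSolution a ∧ I.IsSolution b} ≃
      (Fin t → {c : RBConstraint n d k q // c.IsSatisfiedBy a ∧ c.IsSatisfiedBy b}) :=
    (Equiv.subtypeEquivRight fun I => forall_and.symm).trans
      (Equiv.subtypePiEquivPi (p := fun (_ : Fin t) (c : RBConstraint n d k q) =>
        c.IsSatisfiedBy a ∧ c.IsSatisfiedBy b))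
  rw [Nat.card_congr e, Nat.card_fun, Nat.card_fin]
  rfl

open Classical in
theorem numSolutions_eq_sum {n d k q t : ℕ} (I : RBInstance n d k q t) :
    (I.numSolutions : ℝ) = ∑ a : Fin n → Fin d, if I.IsSolution a then (1 : ℝ) else 0 := by
  rw [RBInstance.numSolutions, Nat.card_eq_fintype_card, Fintype.card_subtype]
  simp

theorem sum_numSolutions (n d k q t : ℕ) :
    ∑ I : RBInstance n d k q t, (I.numSolutions : ℝ) =
      ∑ a : Fin n → Fin d, (jointCount k q a a : ℝ) ^ t := by
  classical
  simp_rw [numSolutions_eq_sum]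
  rw [Finset.sum_comm]
  refine Finset.sum_congr rfl fun a _ => ?_
  rw [← Nat.cast_pow, ← card_common_solution, Nat.card_eq_fintype_card, Fintype.card_subtype]
  simp

theorem sum_numSolutions_sq (n d k q t : ℕ) :
    ∑ I : RBInstance n d k q t, (I.numSolutions : ℝ) ^ 2 =
      ∑ a : Fin n → Fin d, ∑ b : Fin n → Fin d, (jointCount k q a b : ℝ) ^ t := by
  classical
  simp_rw [numSolutions_eq_sum, sq, Finset.sum_mul_sum]
  rw [Finset.sum_comm]
  refine Finset.sum_congr rfl fun a _ => ?_
  rw [Finset.sum_comm]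
  refine Finset.sum_congr rfl fun b _ => ?_
  rw [← Nat.cast_pow, ← card_common_solution, Nat.card_eq_fintype_card, Fintype.card_subtype]
  simp [← ite_and, and_comm]

open Classical in
theorem rbProbSat_eq (n d k q t : ℕ) :
    rbProbSat n d k q t =
      ((Finset.univ.filter fun I : RBInstance n d k q t => 0 < I.numSolutions).card : ℝ) /
        Fintype.card (RBInstance n d k q t) := by
  have hm : MeasurableSet {I : RBInstance n d k q t | 0 < I.numSolutions} := trivial
  rw [rbProbSat, rbLaw, MeasureTheory.measureReal_def, ProbabilityTheory.uniformOn_univ,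
    MeasureTheory.Measure.count_apply hm, Set.encard_eq_coe_toFinset_card]
  simp

theorem rbProbSat_le_one (n d k q t : ℕ) : rbProbSat n d k q t ≤ 1 := by
  classical
  rw [rbProbSat_eq]
  exact div_le_one_of_le₀ (by exact_mod_cast Finset.card_le_univ _) (Nat.cast_nonneg _)

theorem rbProbSat_nonneg (n d k q t : ℕ) : 0 ≤ rbProbSat n d k q t := by
  rw [rbProbSat_eq]
  positivity

/-- Markov's inequality for the number of solutions. -/
theorem rbProbSat_le_mean (n d k q t : ℕ) :
    rbProbSat n d k q t ≤ (∑ I : RBInstance n d k q t, (I.numSolutions : ℝ)) /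
        Fintype.card (RBInstance n d k q t) := by
  classical
  rw [rbProbSat_eq]
  gcongr
  rw [← nsmul_one, ← Finset.sum_const]
  refine (Finset.sum_le_sum fun I hI => ?_).trans
    (Finset.sum_le_sum_of_subset_of_nonneg (Finset.filter_subset _ _)
      fun _ _ _ => Nat.cast_nonneg _)
  exact_mod_cast (Finset.mem_filter.1 hI).2

/-- The second moment inequality `(E X)² ≤ Pr[X > 0] · E X²`. -/
theorem sq_mean_le_rbProbSat_mul (n d k q t : ℕ) :
    (∑ I : RBInstance n d k q t, (I.numSolutions : ℝ)) ^ 2 ≤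
      rbProbSat n d k q t * Fintype.card (RBInstance n d k q t) *
        ∑ I : RBInstance n d k q t, (I.numSolutions : ℝ) ^ 2 := by
  classical
  have hcs := Finset.sum_mul_sq_le_sq_mul_sq (Finset.univ : Finset (RBInstance n d k q t))
    (fun I => if 0 < I.numSolutions then (1 : ℝ) else 0) (fun I => (I.numSolutions : ℝ))
  have h1 : ∀ I : RBInstance n d k q t,
      (if 0 < I.numSolutions then (1 : ℝ) else 0) * (I.numSolutions : ℝ) = I.numSolutions := by
    intro I
    split_ifs with h
    · simp
    · simp [Nat.eq_zero_of_not_pos h]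
  have h2 : ∑ I : RBInstance n d k q t, (if 0 < I.numSolutions then (1 : ℝ) else 0) ^ 2 =
      rbProbSat n d k q t * Fintype.card (RBInstance n d k q t) := by
    rw [rbProbSat_eq, div_mul_cancel_of_imp]
    · simp
    · intro h
      have h0 : Fintype.card (RBInstance n d k q t) = 0 := by exact_mod_cast h
      have := Finset.card_le_univ
        (Finset.univ.filter fun I : RBInstance n d k q t => 0 < I.numSolutions)
      rw [h0] at this
      exact_mod_cast Nat.le_zero.1 this
  simp_rw [h1] at hcs
  rwa [h2] at hcs

/-- The ratio `E X² / (E X)²`, as a binomial average over the number `s` of variables on which two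
assignments agree. -/
noncomputable def momentRatio (n d k q t : ℕ) : ℝ :=
  ∑ s ∈ Finset.range (n + 1), (n.choose s : ℝ) * (1 / (d : ℝ)) ^ s * (1 - 1 / (d : ℝ)) ^ (n - s) *
    (1 + (d : ℝ) ^ k * q / (((d : ℝ) ^ k - q) * ((d : ℝ) ^ k - 1)) *
      ((s.choose k : ℝ) / n.choose k - 1 / (d : ℝ) ^ k)) ^ t

theorem choose_pred_real {N q : ℕ} (hN : 1 ≤ N) (hq : q ≤ N) :
    ((N - 1).choose q : ℝ) = N.choose q * ((N - q : ℝ) / N) := by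
  obtain ⟨M, rfl⟩ : ∃ M, N = M + 1 := ⟨N - 1, by omega⟩
  have h := Nat.choose_mul_succ_eq M q
  have h' : (M.choose q : ℝ) * (M + 1 : ℕ) = (M + 1).choose q * ((M + 1 : ℕ) - q : ℝ) := by
    rw [← Nat.cast_sub hq]
    exact_mod_cast h
  have hM : ((M + 1 : ℕ) : ℝ) ≠ 0 := by positivity
  rw [Nat.add_sub_cancel, mul_div_assoc', ← h', mul_div_cancel_right₀ _ hM]

theorem jointCount_real {n d k q : ℕ} (hk : k ≤ n) (hN : 2 ≤ d ^ k) (hq : q < d ^ k)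
    (a b : Fin n → Fin d) :
    (jointCount k q a b : ℝ) = (n.choose k * (d ^ k).choose q : ℕ) *
      (((d : ℝ) ^ k - q) / (d : ℝ) ^ k) ^ 2 *
      (1 + (d : ℝ) ^ k * q / (((d : ℝ) ^ k - q) * ((d : ℝ) ^ k - 1)) *
      (((agreeSet a b).card.choose k : ℝ) / n.choose k - 1 / (d : ℝ) ^ k)) := by
  have hs : (agreeSet a b).card ≤ n := by simpa using Finset.card_le_univ (agreeSet a b)
  have hle : (agreeSet a b).card.choose k ≤ n.choose k := Nat.choose_le_choose k hs
  rw [jointCount_eq]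
  have h1 := choose_pred_real (N := d ^ k) (q := q) (by omega) hq.le
  have h2 := choose_pred_real (N := d ^ k - 1) (q := q) (by omega) (by omega)
  rw [show d ^ k - 1 - 1 = d ^ k - 2 by omega, h1] at h2
  have hn : (n.choose k : ℝ) ≠ 0 := by exact_mod_cast (Nat.choose_pos hk).ne'
  have hN' : (2 : ℝ) ≤ (d : ℝ) ^ k := by exact_mod_cast hN
  have hq' : (q : ℝ) < (d : ℝ) ^ k := by exact_mod_cast hq
  push_cast [Nat.cast_sub hle] at *
  rw [h1, h2, Nat.cast_sub (by omega)]
  push_cast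
  generalize ((d : ℝ) ^ k) = N at *
  have e1 : N ≠ 0 := by linarith
  have e2 : N - q ≠ 0 := by linarith
  have e3 : N - 1 ≠ 0 := by linarith
  field_simp
  ring

theorem jointCount_self {n d k q : ℕ} (hd : 1 ≤ d) (hq : q ≤ d ^ k) (a : Fin n → Fin d) :
    (jointCount k q a a : ℝ) = (n.choose k * (d ^ k).choose q : ℕ) *
      (((d : ℝ) ^ k - q) / (d : ℝ) ^ k) := by
  have : agreeSet a a = Finset.univ := by simp [agreeSet]
  have h1 := choose_pred_real (N := d ^ k) (q := q) (Nat.one_le_pow _ _ hd) hq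
  rw [jointCount_eq, this, Finset.card_univ, Fintype.card_fin, Nat.sub_self, zero_mul, add_zero]
  push_cast at *
  rw [h1, mul_assoc]

theorem sum_numSolutions_eq {n d k q : ℕ} (t : ℕ) (hd : 1 ≤ d) (hq : q ≤ d ^ k) :
    ∑ I : RBInstance n d k q t, (I.numSolutions : ℝ) =
      (d : ℝ) ^ n * (Fintype.card (RBInstance n d k q t) *
        (((d : ℝ) ^ k - q) / (d : ℝ) ^ k) ^ t) := by
  rw [sum_numSolutions]
  simp_rw [jointCount_self hd hq]
  rw [Finset.sum_const, Finset.card_univ, card_rbInstance, mul_pow]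
  simp

theorem card_rbInstance_pos {n d k q : ℕ} (t : ℕ) (hk : k ≤ n) (hq : q ≤ d ^ k) :
    0 < (Fintype.card (RBInstance n d k q t) : ℝ) := by
  rw [card_rbInstance]
  have := Nat.choose_pos hk
  have := Nat.choose_pos hq
  positivity

theorem rbProbSat_le {n d k q : ℕ} (t : ℕ) (hk : k ≤ n) (hd : 1 ≤ d) (hq : q ≤ d ^ k) :
    rbProbSat n d k q t ≤ (d : ℝ) ^ n * (((d : ℝ) ^ k - q) / (d : ℝ) ^ k) ^ t := by
  have h := rbProbSat_le_mean n d k q t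
  rwa [sum_numSolutions_eq t hd hq, mul_left_comm, mul_div_cancel_left₀ _
    (card_rbInstance_pos t hk hq).ne'] at h

theorem one_le_rbProbSat_mul_momentRatio {n d k q : ℕ} (t : ℕ) (hk : k ≤ n) (hd : 1 ≤ d)
    (hN : 2 ≤ d ^ k) (hq : q < d ^ k) :
    1 ≤ rbProbSat n d k q t * momentRatio n d k q t := by
  have hZ := card_rbInstance_pos (n := n) t hk hq.le
  have hd0 : (0 : ℝ) < d := by exact_mod_cast hd
  have hq' : (q : ℝ) < (d : ℝ) ^ k := by exact_mod_cast hq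
  have h := sq_mean_le_rbProbSat_mul n d k q t
  have hsq : ∑ I : RBInstance n d k q t, (I.numSolutions : ℝ) ^ 2 =
      ((d : ℝ) ^ n * (((d : ℝ) ^ k - q) / (d : ℝ) ^ k) ^ t) ^ 2 *
        Fintype.card (RBInstance n d k q t) * momentRatio n d k q t := by
    rw [sum_numSolutions_sq]
    simp_rw [jointCount_real hk hN hq]
    rw [Finset.sum_congr rfl fun a _ => sum_agreeSet_card a fun s =>
      ((n.choose k * (d ^ k).choose q : ℕ) * (((d : ℝ) ^ k - q) / (d : ℝ) ^ k) ^ 2 *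
      (1 + (d : ℝ) ^ k * q / (((d : ℝ) ^ k - q) * ((d : ℝ) ^ k - 1)) *
      ((s.choose k : ℝ) / n.choose k - 1 / (d : ℝ) ^ k))) ^ t]
    rw [Finset.sum_const, Finset.card_univ, card_rbInstance, momentRatio, Finset.mul_sum,
      Finset.smul_sum]
    refine Finset.sum_congr rfl fun s hs => ?_
    have hsn : s ≤ n := Nat.lt_succ_iff.1 (Finset.mem_range.1 hs)
    have hb : (d : ℝ) ^ n * ((1 / (d : ℝ)) ^ s * (1 - 1 / (d : ℝ)) ^ (n - s)) =
        ((d - 1 : ℕ) : ℝ) ^ (n - s) := by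
      rw [Nat.cast_sub hd, Nat.cast_one, show (d : ℝ) ^ n = d ^ s * d ^ (n - s) by
        rw [← pow_add, Nat.add_sub_cancel' hsn], mul_mul_mul_comm, ← mul_pow, ← mul_pow,
        mul_one_div_cancel hd0.ne', one_pow, one_mul, mul_sub, mul_one,
        mul_one_div_cancel hd0.ne']
    rw [← hb]
    simp only [Fintype.card_pi, Fintype.card_fin, Finset.prod_const, Finset.card_univ,
      nsmul_eq_mul, mul_pow]
    push_cast
    generalize ((d : ℝ) ^ k - q) / (d : ℝ) ^ k = y
    ring
  rw [sum_numSolutions_eq t hd hq.le, hsq] at h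
  have hpos : 0 < ((d : ℝ) ^ n * (Fintype.card (RBInstance n d k q t) *
        (((d : ℝ) ^ k - q) / (d : ℝ) ^ k) ^ t)) ^ 2 := by
    have : 0 < ((d : ℝ) ^ k - q) / (d : ℝ) ^ k := div_pos (by linarith) (by positivity)
    positivity
  refine le_of_mul_le_mul_left ?_ hpos
  calc _ = _ := mul_one _
    _ ≤ _ := h
    _ = _ := by ring

/-! ### Elementary estimates -/

theorem choose_div_choose_le {n s : ℕ} (k : ℕ) (hs : s ≤ n) (hk : k ≤ n) :
    (s.choose k : ℝ) / n.choose k ≤ ((s : ℝ) / n) ^ k := by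
  induction k with
  | zero => simp
  | succ k ih =>
    have ih := ih (by omega)
    rcases Nat.lt_or_ge s (k + 1) with h | h
    · rw [Nat.choose_eq_zero_of_lt h]
      simp only [Nat.cast_zero, zero_div]
      positivity
    have hn : (0 : ℝ) < n := by exact_mod_cast (by omega : 0 < n)
    have hnk : (0 : ℝ) < (n : ℝ) - k := by
      have : (k : ℝ) + 1 ≤ n := by exact_mod_cast hk
      linarith
    have hstep : ∀ m : ℕ, k + 1 ≤ m →
        (m.choose (k + 1) : ℝ) = m.choose k * ((m : ℝ) - k) / (k + 1) := by
      intro m hm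
      rw [eq_div_iff (by positivity), ← Nat.cast_sub (by omega)]
      exact_mod_cast Nat.choose_succ_right_eq m k
    have hC : (0 : ℝ) < n.choose k := by exact_mod_cast Nat.choose_pos (by omega)
    have hsn : (s : ℝ) ≤ n := by exact_mod_cast hs
    have hfrac : ((s : ℝ) - k) / (n - k) ≤ s / n := by
      rw [div_le_div_iff₀ hnk hn]
      nlinarith [(Nat.cast_nonneg k : (0 : ℝ) ≤ k)]
    have hsk : (0 : ℝ) ≤ (s : ℝ) - k := by
      have : (k : ℝ) + 1 ≤ s := by exact_mod_cast h
      linarith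
    calc (s.choose (k + 1) : ℝ) / n.choose (k + 1)
        = (s.choose k / n.choose k) * (((s : ℝ) - k) / (n - k)) := by
          rw [hstep s h, hstep n hk]
          field_simp
      _ ≤ ((s : ℝ) / n) ^ k * (s / n) := by gcongr
      _ = _ := (pow_succ _ _).symm

theorem choose_le_exp_mul_div_pow {n s : ℕ} (hs : 1 ≤ s) :
    (n.choose s : ℝ) ≤ (Real.exp 1 * n / s) ^ s := by
  have hs0 : (0 : ℝ) < s := by exact_mod_cast hs
  have h1 : (n.choose s : ℝ) ≤ (n : ℝ) ^ s / s.factorial := Nat.choose_le_pow_div s n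
  have h2 := Real.pow_div_factorial_le_exp (s : ℝ) hs0.le s
  have hf : (0 : ℝ) < s.factorial := by exact_mod_cast s.factorial_pos
  refine h1.trans ?_
  rw [div_pow, mul_pow, Real.exp_one_pow, div_le_div_iff₀ hf (by positivity)]
  rw [div_le_iff₀ hf] at h2
  calc (n : ℝ) ^ s * s ^ s ≤ n ^ s * (Real.exp s * s.factorial) := by gcongr
    _ = _ := by ring

theorem pow_sub_pow_le_mul {x y z : ℝ} (k : ℕ) (hx : 0 ≤ x) (hxz : x ≤ z) (hy : 0 ≤ y)
    (hyz : y ≤ z) :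
    y ^ k - x ^ k ≤ k * z ^ (k - 1) * max (y - x) 0 := by
  have hz : 0 ≤ z := hx.trans hxz
  rcases le_total y x with h | h
  · rw [max_eq_right (by linarith), mul_zero, sub_nonpos]
    gcongr
  · rw [max_eq_left (by linarith), ← Commute.geom_sum₂_mul (Commute.all y x)]
    refine mul_le_mul_of_nonneg_right ?_ (by linarith)
    calc ∑ i ∈ Finset.range k, y ^ i * x ^ (k - 1 - i)
        ≤ ∑ i ∈ Finset.range k, z ^ (k - 1) := by
          refine Finset.sum_le_sum fun i hi => ?_
          have : k - 1 = i + (k - 1 - i) := by have := Finset.mem_range.1 hi; omega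
          nth_rewrite 2 [this]
          rw [pow_add]
          gcongr
      _ = _ := by simp

/-- The condition `k ≥ τ log τ / (τ - 1)` enters only here: it makes `(τ ^ σ - 1) / σ ^ k`
nonincreasing on `(0, 1]`, and the value at `σ = 1` is `τ - 1`. -/
theorem one_add_mul_pow_le_exp {L σ : ℝ} {k : ℕ} (hk : 1 ≤ k)
    (hLk : L * Real.exp L ≤ k * (Real.exp L - 1)) (h0 : 0 ≤ σ) (h1 : σ ≤ 1) :
    1 + (Real.exp L - 1) * σ ^ k ≤ Real.exp (σ * L) := by
  rcases h0.eq_or_lt with rfl | h0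
  · simp [show k ≠ 0 by omega]
  -- convexity of `exp` bounds `1 - exp (-x)` below by the chord on `[0, L]`
  have hchord : ∀ x : ℝ, 0 < x → x ≤ 1 →
      x * L * Real.exp (x * L) ≤ k * (Real.exp (x * L) - 1) := by
    intro x hx0 hx1
    have hc := convexOn_exp.2 (Set.mem_univ (-L)) (Set.mem_univ 0) hx0.le
      (by linarith : 0 ≤ 1 - x) (by ring)
    simp only [smul_eq_mul, mul_zero, add_zero, Real.exp_zero, mul_one] at hc
    rw [show x * -L = -(x * L) by ring] at hc
    have hL' : L ≤ k * (1 - Real.exp (-L)) := by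
      have := mul_le_mul_of_nonneg_right hLk (Real.exp_pos (-L)).le
      rw [mul_assoc, ← Real.exp_add, add_neg_cancel, Real.exp_zero, mul_one, mul_assoc, sub_mul,
        ← Real.exp_add, add_neg_cancel, Real.exp_zero, one_mul] at this
      exact this
    have h2 : x * L ≤ k * (1 - Real.exp (-(x * L))) := by
      have h3 : x * L ≤ x * (k * (1 - Real.exp (-L))) := mul_le_mul_of_nonneg_left hL' hx0.le
      have h4 : (k : ℝ) * (x * (1 - Real.exp (-L))) ≤ k * (1 - Real.exp (-(x * L))) :=
        mul_le_mul_of_nonneg_left (by linarith) (Nat.cast_nonneg k)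
      linarith
    have h5 := mul_le_mul_of_nonneg_right h2 (Real.exp_pos (x * L)).le
    rwa [mul_assoc (k : ℝ), sub_mul, ← Real.exp_add, neg_add_cancel, Real.exp_zero, one_mul] at h5
  set G : ℝ → ℝ := fun x => (Real.exp (x * L) - 1) / x ^ k with hG
  have hder : ∀ x : ℝ, 0 < x → HasDerivAt G
      ((Real.exp (x * L) * L * x ^ k - (Real.exp (x * L) - 1) * (k * x ^ (k - 1))) /
        (x ^ k) ^ 2) x := by
    intro x hx
    have e1 : HasDerivAt (fun x : ℝ => Real.exp (x * L) - 1) (Real.exp (x * L) * L) x := by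
      simpa using (((hasDerivAt_id x).mul_const L).exp).sub_const 1
    exact e1.div (hasDerivAt_pow k x) (by positivity)
  have hanti : AntitoneOn G (Set.Icc σ 1) := by
    refine antitoneOn_of_deriv_nonpos (convex_Icc _ _) ?_ ?_ ?_
    · intro x hx
      exact (hder x (h0.trans_le hx.1)).continuousAt.continuousWithinAt
    · intro x hx
      rw [interior_Icc] at hx
      exact (hder x (h0.trans hx.1)).differentiableAt.differentiableWithinAt
    · intro x hx
      rw [interior_Icc] at hx
      have hx0 := h0.trans hx.1
      rw [(hder x hx0).deriv]
      refine div_nonpos_of_nonpos_of_nonneg ?_ (by positivity)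
      have e : x ^ k = x * x ^ (k - 1) := by rw [← pow_succ', Nat.sub_add_cancel hk]
      rw [e]
      have := mul_le_mul_of_nonneg_right (hchord x hx0 hx.2.le)
        (by positivity : 0 ≤ x ^ (k - 1))
      linarith
  have h := hanti ⟨le_rfl, h1⟩ ⟨h1, le_rfl⟩ h1
  simp only [hG, one_mul, one_pow, div_one] at h
  rw [le_div_iff₀ (by positivity)] at h
  linarith

theorem exp_max_zero_le {u η : ℝ} (hη : 0 < η) :
    Real.exp (max u 0) ≤ 1 + η + (Real.exp u - 1) ^ 2 / (4 * η) := by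
  have hdiv : 0 ≤ (Real.exp u - 1) ^ 2 / (4 * η) := by positivity
  rcases le_total u 0 with h | h
  · rw [max_eq_right h, Real.exp_zero]
    linarith
  · rw [max_eq_left h]
    have : Real.exp u - 1 - η ≤ (Real.exp u - 1) ^ 2 / (4 * η) := by
      rw [le_div_iff₀ (by positivity)]
      nlinarith [sq_nonneg (Real.exp u - 1 - 2 * η)]
    linarith

/-- The moment generating function of the binomial distribution. -/
theorem sum_binomial_mul_exp (n : ℕ) (x θ : ℝ) :
    ∑ s ∈ Finset.range (n + 1), (n.choose s : ℝ) * x ^ s * (1 - x) ^ (n - s) *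
      Real.exp (θ * (s - n * x)) =
      ((x * Real.exp θ + (1 - x)) * Real.exp (-(θ * x))) ^ n := by
  rw [mul_pow, add_pow, Finset.sum_mul]
  refine Finset.sum_congr rfl fun s _ => ?_
  rw [mul_pow, ← Real.exp_nat_mul, ← Real.exp_nat_mul, show θ * (s - n * x) = s * θ + n * -(θ * x)
    by ring, Real.exp_add]
  ring

/-- The positive part of a centred binomial variable has an exponential moment close to `1` as soon
as `θ` is small compared with the inverse standard deviation. -/
theorem sum_binomial_mul_exp_max_le (n : ℕ) {x θ η : ℝ} (hx0 : 0 ≤ x) (hx1 : x ≤ 1) (hθ0 : 0 ≤ θ)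
    (hθ : θ ≤ 1 / 2) (hη : 0 < η) :
    ∑ s ∈ Finset.range (n + 1), (n.choose s : ℝ) * x ^ s * (1 - x) ^ (n - s) *
      Real.exp (θ * max (s - n * x) 0) ≤
      1 + η + (Real.exp (4 * θ ^ 2 * n * x) - 1) / (4 * η) := by
  set b : ℕ → ℝ := fun s => (n.choose s : ℝ) * x ^ s * (1 - x) ^ (n - s) with hb
  have hb0 : ∀ s, 0 ≤ b s := fun s => by
    have : 0 ≤ 1 - x := by linarith
    positivity
  have hsum : ∑ s ∈ Finset.range (n + 1), b s = 1 := by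
    have := sum_binomial_mul_exp n x 0
    simpa using this
  have hpt : ∀ s ∈ Finset.range (n + 1), b s * Real.exp (θ * max (s - n * x) 0) ≤
      b s * (1 + η + 1 / (4 * η)) + (b s * Real.exp ((2 * θ) * (s - n * x))) / (4 * η) -
        (b s * Real.exp (θ * (s - n * x))) / (2 * η) := by
    intro s _
    have h := exp_max_zero_le (u := θ * (s - n * x)) hη
    rw [mul_max_of_nonneg _ _ hθ0, mul_zero]
    have h2 := mul_le_mul_of_nonneg_left h (hb0 s)
    refine h2.trans_eq ?_
    rw [show 2 * θ * (s - n * x) = θ * (s - n * x) + θ * (s - n * x) by ring, Real.exp_add]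
    field_simp
    ring
  have hM1 : 1 ≤ ∑ s ∈ Finset.range (n + 1), b s * Real.exp (θ * (s - n * x)) := by
    rw [sum_binomial_mul_exp]
    refine one_le_pow₀ ?_
    have h1 := Real.add_one_le_exp θ
    calc (1 : ℝ) = Real.exp (θ * x) * Real.exp (-(θ * x)) := by
          rw [← Real.exp_add, add_neg_cancel, Real.exp_zero]
      _ ≤ _ := by
        gcongr
        have hc := convexOn_exp.2 (Set.mem_univ θ) (Set.mem_univ 0) hx0
          (by linarith : 0 ≤ 1 - x) (by ring)
        simp only [smul_eq_mul, mul_zero, add_zero, Real.exp_zero, mul_one] at hc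
        rwa [mul_comm θ x]
  have hM2 : ∑ s ∈ Finset.range (n + 1), b s * Real.exp ((2 * θ) * (s - n * x)) ≤
      Real.exp (4 * θ ^ 2 * n * x) := by
    rw [sum_binomial_mul_exp]
    have hexp : Real.exp (2 * θ) ≤ 1 + 2 * θ + (2 * θ) ^ 2 := by
      have := Real.abs_exp_sub_one_sub_id_le (x := 2 * θ) (by rw [abs_of_nonneg] <;> linarith)
      have := (abs_le.1 this).2
      linarith
    rw [show 4 * θ ^ 2 * n * x = n * (4 * θ ^ 2 * x) by ring, Real.exp_nat_mul]
    have h0 : 0 ≤ x * Real.exp (2 * θ) + (1 - x) := by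
      have : 0 ≤ 1 - x := by linarith
      positivity
    refine pow_le_pow_left₀ (mul_nonneg h0 (Real.exp_pos _).le) ?_ n
    calc (x * Real.exp (2 * θ) + (1 - x)) * Real.exp (-(2 * θ * x))
        ≤ Real.exp (2 * θ * x + 4 * θ ^ 2 * x) * Real.exp (-(2 * θ * x)) := by
          gcongr
          have := Real.add_one_le_exp (2 * θ * x + 4 * θ ^ 2 * x)
          nlinarith [mul_le_mul_of_nonneg_left hexp hx0]
      _ = _ := by rw [← Real.exp_add]; ring_nf
  calc _ ≤ _ := Finset.sum_le_sum hpt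
    _ = (1 + η + 1 / (4 * η)) +
        (∑ s ∈ Finset.range (n + 1), b s * Real.exp ((2 * θ) * (s - n * x))) / (4 * η) -
        (∑ s ∈ Finset.range (n + 1), b s * Real.exp (θ * (s - n * x))) / (2 * η) := by
      rw [Finset.sum_sub_distrib, Finset.sum_add_distrib, ← Finset.sum_mul, hsum, one_mul,
        Finset.sum_div, Finset.sum_div]
    _ ≤ (1 + η + 1 / (4 * η)) + Real.exp (4 * θ ^ 2 * n * x) / (4 * η) - 1 / (2 * η) := by
      gcongr
    _ = _ := by
      field_simp
      ring

theorem sum_pow_succ_le {ρ : ℝ} (h0 : 0 ≤ ρ) (h1 : ρ ≤ 1 / 2) (n : ℕ) :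
    ∑ s ∈ Finset.range n, ρ ^ (s + 1) ≤ 2 * ρ := by
  have h := (summable_geometric_of_lt_one h0 (by linarith)).sum_le_tsum (Finset.range n)
    fun i _ => pow_nonneg h0 i
  rw [tsum_geometric_of_lt_one h0 (by linarith)] at h
  simp_rw [pow_succ']
  rw [← Finset.mul_sum, mul_comm 2 ρ]
  refine mul_le_mul_of_nonneg_left (h.trans ?_) h0
  rw [inv_le_comm₀ (by linarith) (by norm_num)]
  linarith

/-! ### The second moment -/

/-- The binomial coefficient is at most `(e n / s) ^ s`, so a binomial term with a weight
`g ≤ E ^ s` is at most `(e n x E / s) ^ s`: small as soon as `s / n` is large against `x * E`. -/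
theorem binomial_term_le_pow {n s : ℕ} {x g E ρ : ℝ} (hs : 1 ≤ s) (hx0 : 0 ≤ x)
    (hx1 : x ≤ 1) (hE : 0 ≤ E) (hg0 : 0 ≤ g) (hg : g ≤ E ^ s)
    (hρ : Real.exp 1 * n / s * x * E ≤ ρ) :
    (n.choose s : ℝ) * x ^ s * (1 - x) ^ (n - s) * g ≤ ρ ^ s := by
  have h1 : (1 - x) ^ (n - s) ≤ 1 := pow_le_one₀ (by linarith) (by linarith)
  have h0 : 0 ≤ (1 - x) ^ (n - s) := pow_nonneg (by linarith) _
  calc (n.choose s : ℝ) * x ^ s * (1 - x) ^ (n - s) * g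
      ≤ (Real.exp 1 * n / s) ^ s * x ^ s * 1 * E ^ s := by
        gcongr
        exact choose_le_exp_mul_div_pow hs
    _ = (Real.exp 1 * n / s * x * E) ^ s := by rw [mul_one, ← mul_pow, ← mul_pow]
    _ ≤ ρ ^ s := by gcongr

/-- A bound for the second moment ratio in terms of a cutoff `w`, which plays the role of a small
negative power of `d`. The terms with `s / n ≤ 1 / (d * w)` contribute at most
`1 + o(1)`, because the exponent is linearised around the mean `n / d` of `s`; the terms with
`s / n` between `1 / (d * w)` and `w`, and those above `w`, are bounded by a geometric series. -/
theorem momentRatio_le {n d k q t : ℕ} {C w m L η θ : ℝ} (hn : 1 ≤ n) (hk : 2 ≤ k) (hkn : k ≤ n)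
    (hd : 1 ≤ d) (hN : 2 ≤ d ^ k) (hq : q < d ^ k)
    (hC : C = (d : ℝ) ^ k * q / (((d : ℝ) ^ k - q) * ((d : ℝ) ^ k - 1)))
    (hCN : C ≤ (d : ℝ) ^ k) (hw0 : 0 < w) (hw : Real.exp 2 * w ≤ 1 / 2) (hL : 0 < L)
    (hLk : L * Real.exp L ≤ k * (Real.exp L - 1)) (hm : 1 ≤ m) (hCm : C ≤ m * (Real.exp L - 1))
    (hmid : t * C * w ≤ n) (hhigh : Real.exp (m * t * L / n) ≤ d * w ^ 2)
    (hθ : θ = t * C * k * (1 / (d * w)) ^ (k - 1) / n) (hθ2 : θ ≤ 1 / 2) (hη : 0 < η) :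
    momentRatio n d k q t ≤
      1 + η + (Real.exp (4 * θ ^ 2 * n * (1 / d)) - 1) / (4 * η) + 2 * (Real.exp 2 * w) := by
  have hn0 : (0 : ℝ) < n := by exact_mod_cast hn
  have hd1 : (1 : ℝ) ≤ d := by exact_mod_cast hd
  have hd0 : (0 : ℝ) < d := by linarith
  have hN2 : (2 : ℝ) ≤ (d : ℝ) ^ k := by exact_mod_cast hN
  have hqN : (q : ℝ) < (d : ℝ) ^ k := by exact_mod_cast hq
  have hC0 : 0 ≤ C := by
    rw [hC]
    exact div_nonneg (by positivity) (mul_nonneg (by linarith) (by linarith))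
  have hw1 : w ≤ 1 := by
    have h1 : (1 : ℝ) ≤ Real.exp 2 := Real.one_le_exp (by norm_num)
    nlinarith
  have hθ0 : 0 ≤ θ := by rw [hθ]; positivity
  have hc0 : 0 ≤ Real.exp L - 1 := by have := Real.one_le_exp hL.le; linarith
  set x : ℝ := 1 / (d : ℝ) with hx
  have hx0 : 0 ≤ x := by positivity
  have hx1 : x ≤ 1 := by rw [hx, div_le_one hd0]; exact hd1
  have hxz : x ≤ 1 / (d * w) := by
    rw [hx]
    exact one_div_le_one_div_of_le (by positivity) (by nlinarith)
  rw [momentRatio, ← hC]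
  have hpt : ∀ s ∈ Finset.range (n + 1), (n.choose s : ℝ) * x ^ s * (1 - x) ^ (n - s) *
      (1 + C * ((s.choose k : ℝ) / n.choose k - 1 / (d : ℝ) ^ k)) ^ t ≤
      (n.choose s : ℝ) * x ^ s * (1 - x) ^ (n - s) * Real.exp (θ * max (s - n * x) 0) +
        (if s = 0 then 0 else (Real.exp 2 * w) ^ s) := by
    intro s hs
    have hsn : s ≤ n := Nat.lt_succ_iff.1 (Finset.mem_range.1 hs)
    have hsn' : (s : ℝ) ≤ n := by exact_mod_cast hsn
    have hh := choose_div_choose_le k hsn hkn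
    have hh0 : 0 ≤ (s.choose k : ℝ) / n.choose k := by positivity
    set h : ℝ := (s.choose k : ℝ) / n.choose k
    set σ : ℝ := (s : ℝ) / n with hσ
    have hσ0 : 0 ≤ σ := by positivity
    have hσ1 : σ ≤ 1 := by rw [hσ, div_le_one hn0]; exact hsn'
    have hsσ : (s : ℝ) = σ * n := by rw [hσ]; field_simp
    have h1x : 0 ≤ 1 - x := by linarith
    have hxk : x ^ k = 1 / (d : ℝ) ^ k := by rw [hx, one_div_pow]
    have hbase : 0 ≤ 1 + C * (h - 1 / (d : ℝ) ^ k) := by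
      have : C * (1 / (d : ℝ) ^ k) ≤ 1 := by
        rw [mul_one_div]
        exact div_le_one_of_le₀ hCN (by positivity)
      nlinarith [mul_nonneg hC0 hh0]
    rcases le_or_gt σ (1 / (d * w)) with hlow | hlow
    · have hE0 : 0 ≤ (if s = 0 then 0 else (Real.exp 2 * w) ^ s : ℝ) := by
        split_ifs
        · exact le_rfl
        · positivity
      have hg : (1 + C * (h - 1 / (d : ℝ) ^ k)) ^ t ≤ Real.exp (θ * max (s - n * x) 0) := by
        have h1 := pow_sub_pow_le_mul k hx0 hxz hσ0 hlow
        have h2 : 1 + C * (h - 1 / (d : ℝ) ^ k) ≤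
            Real.exp (C * (k * (1 / (d * w)) ^ (k - 1) * max (σ - x) 0)) := by
          have h3 := Real.add_one_le_exp (C * (k * (1 / (d * w)) ^ (k - 1) * max (σ - x) 0))
          have h4 : C * (h - 1 / (d : ℝ) ^ k) ≤
              C * (k * (1 / (d * w)) ^ (k - 1) * max (σ - x) 0) := by
            rw [← hxk]
            exact mul_le_mul_of_nonneg_left (by linarith) hC0
          linarith
        refine (pow_le_pow_left₀ hbase h2 t).trans_eq ?_
        rw [← Real.exp_nat_mul]
        congr 1
        have : max ((s : ℝ) - n * x) 0 = n * max (σ - x) 0 := by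
          rw [mul_max_of_nonneg _ _ hn0.le, mul_zero, mul_sub, hsσ]
          ring_nf
        rw [this, hθ]
        field_simp
      have hb0 : 0 ≤ (n.choose s : ℝ) * x ^ s * (1 - x) ^ (n - s) := by positivity
      have := mul_le_mul_of_nonneg_left hg hb0
      linarith
    · have hσpos : 0 < σ := lt_of_le_of_lt (by positivity) hlow
      have hs0 : s ≠ 0 := by
        rintro rfl
        simp [hσ] at hσpos
      rw [if_neg hs0]
      have hb0 : 0 ≤ (n.choose s : ℝ) * x ^ s * (1 - x) ^ (n - s) *
        Real.exp (θ * max (s - n * x) 0) := by positivity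
      refine le_trans ?_ (le_add_of_nonneg_left hb0)
      have hbC : 1 + C * (h - 1 / (d : ℝ) ^ k) ≤ 1 + C * σ ^ k := by
        have : 0 ≤ 1 / (d : ℝ) ^ k := by positivity
        have := mul_le_mul_of_nonneg_left (show h - 1 / (d : ℝ) ^ k ≤ σ ^ k by linarith) hC0
        linarith
      have hns : Real.exp 1 * n / s = Real.exp 1 / σ := by
        rw [hσ]; field_simp
      have he12 : Real.exp 1 * Real.exp 1 = Real.exp 2 := by
        rw [← Real.exp_add]; norm_num
      rcases le_or_gt σ w with hσw | hσw
      · -- here the weight is at most `e ^ s`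
        refine binomial_term_le_pow (E := Real.exp 1) (Nat.one_le_iff_ne_zero.2 hs0) hx0 hx1
          (Real.exp_pos _).le (pow_nonneg hbase t) ?_ ?_
        · have h1 : 1 + C * (h - 1 / (d : ℝ) ^ k) ≤ Real.exp (C * σ ^ k) := by
            have := Real.add_one_le_exp (C * σ ^ k)
            linarith
          refine (pow_le_pow_left₀ hbase h1 t).trans ?_
          rw [← Real.exp_nat_mul, ← Real.exp_nat_mul, mul_one]
          refine Real.exp_le_exp.2 ?_
          have h2 : σ ^ k ≤ w * σ := by
            calc σ ^ k ≤ σ ^ 2 := pow_le_pow_of_le_one hσ0 hσ1 hk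
              _ = σ * σ := sq σ
              _ ≤ w * σ := by gcongr
          calc (t : ℝ) * (C * σ ^ k) ≤ t * (C * (w * σ)) := by gcongr
            _ = (t * C * w) * σ := by ring
            _ ≤ n * σ := by gcongr
            _ = s := by rw [hsσ]; ring
        · rw [hns]
          have h3 : x / σ ≤ w := by
            rw [div_le_iff₀ hσpos, hx]
            have := hlow.le
            rw [div_le_iff₀ (by positivity)] at this
            rw [div_le_iff₀ hd0]
            linarith
          calc Real.exp 1 / σ * x * Real.exp 1 = Real.exp 2 * (x / σ) := by
                rw [← he12]; ring
            _ ≤ _ := by gcongr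
      · -- here the weight is at most `(d * w ^ 2) ^ s`
        refine binomial_term_le_pow (E := d * w ^ 2) (Nat.one_le_iff_ne_zero.2 hs0) hx0 hx1
          (by positivity) (pow_nonneg hbase t) ?_ ?_
        · have hy : 0 ≤ (Real.exp L - 1) * σ ^ k := by positivity
          have h1 : 1 + C * (h - 1 / (d : ℝ) ^ k) ≤ Real.exp (σ * L * m) := by
            calc 1 + C * (h - 1 / (d : ℝ) ^ k) ≤ 1 + C * σ ^ k := hbC
              _ ≤ 1 + m * ((Real.exp L - 1) * σ ^ k) := by
                rw [← mul_assoc]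
                gcongr
              _ ≤ (1 + (Real.exp L - 1) * σ ^ k) ^ m :=
                one_add_mul_self_le_rpow_one_add (by linarith) hm
              _ ≤ (Real.exp (σ * L)) ^ m := by
                refine Real.rpow_le_rpow (by linarith) ?_ (by linarith)
                exact one_add_mul_pow_le_exp (by omega) hLk hσ0 hσ1
              _ = _ := (Real.exp_mul _ _).symm
          refine (pow_le_pow_left₀ hbase h1 t).trans ?_
          calc (Real.exp (σ * L * m)) ^ t = (Real.exp (m * t * L / n)) ^ s := by
                rw [← Real.exp_nat_mul, ← Real.exp_nat_mul, hσ]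
                congr 1
                ring
            _ ≤ _ := pow_le_pow_left₀ (Real.exp_pos _).le hhigh s
        · rw [hns]
          have h3 : w / σ ≤ 1 := by
            rw [div_le_one hσpos]; exact hσw.le
          have h4 : Real.exp 1 ≤ Real.exp 2 := Real.exp_le_exp.2 (by norm_num)
          calc Real.exp 1 / σ * x * (d * w ^ 2) = Real.exp 1 * w * (w / σ) := by
                rw [hx]; field_simp
            _ ≤ Real.exp 2 * w * 1 := by gcongr
            _ = _ := mul_one _
  refine (Finset.sum_le_sum hpt).trans ?_
  rw [Finset.sum_add_distrib]
  refine add_le_add (sum_binomial_mul_exp_max_le n hx0 hx1 hθ0 hθ2 hη) ?_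
  rw [Finset.sum_range_succ']
  simp only [Nat.add_eq_zero_iff, one_ne_zero, and_false, if_false, if_true, add_zero]
  exact sum_pow_succ_le (by positivity) hw n

/-! ### Asymptotics of the parameters -/

theorem tendsto_div_of_abs_sub_lt_one {u v w : ℕ → ℝ} {c : ℝ} (hv : Tendsto v atTop atTop)
    (hu : ∀ n, u n = c * v n) (h : ∀ n, |w n - u n| < 1) :
    Tendsto (fun n => w n / v n) atTop (𝓝 c) := by
  have h0 : Tendsto (fun n => (v n)⁻¹) atTop (𝓝 0) := hv.inv_tendsto_atTop
  rw [tendsto_iff_dist_tendsto_zero]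
  refine squeeze_zero' (Eventually.of_forall fun n => dist_nonneg) ?_ h0
  filter_upwards [hv.eventually_gt_atTop 0] with n hn
  have e : w n / v n - c = (w n - u n) / v n := by
    rw [hu n]; field_simp
  rw [Real.dist_eq, e, abs_div, abs_of_pos hn, div_eq_mul_inv]
  exact mul_le_of_le_one_left (by positivity) (h n).le

theorem tendsto_log_mul_rpow_neg {β : ℝ} (hβ : 0 < β) :
    Tendsto (fun x : ℝ => Real.log x * x ^ (-β)) atTop (𝓝 0) := by
  refine ((isLittleO_log_rpow_atTop hβ).tendsto_div_nhds_zero).congr' ?_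
  filter_upwards [eventually_ge_atTop 0] with x hx
  rw [Real.rpow_neg hx, div_eq_mul_inv]

theorem tendsto_domain_atTop {α : ℝ} {d : ℕ → ℕ} (hα : 0 < α)
    (hd : ∀ n : ℕ, |(d n : ℝ) - (n : ℝ) ^ α| < 1) :
    Tendsto (fun n => (d n : ℝ)) atTop atTop := by
  have h := (tendsto_rpow_atTop hα).comp (tendsto_natCast_atTop_atTop (R := ℝ))
  refine tendsto_atTop_mono (fun n => ?_) (tendsto_atTop_add_const_right _ (-1) h)
  have := (abs_lt.1 (hd n)).1
  simp only [Function.comp_apply]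
  linarith

theorem tendsto_natCast_div_domain_rpow {α : ℝ} {d : ℕ → ℕ} (hα : 0 < α)
    (hd : ∀ n : ℕ, |(d n : ℝ) - (n : ℝ) ^ α| < 1) :
    Tendsto (fun n : ℕ => (n : ℝ) / (d n : ℝ) ^ (1 / α)) atTop (𝓝 1) := by
  have h1 : Tendsto (fun n : ℕ => (d n : ℝ) / (n : ℝ) ^ α) atTop (𝓝 1) :=
    tendsto_div_of_abs_sub_lt_one ((tendsto_rpow_atTop hα).comp tendsto_natCast_atTop_atTop)
      (fun n => (one_mul _).symm) hd
  have h2 := (h1.rpow_const (p := 1 / α) (Or.inl one_ne_zero)).inv₀ (by simp)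
  simp only [Real.one_rpow, inv_one] at h2
  refine h2.congr fun n => ?_
  rw [Real.div_rpow (by positivity) (by positivity), ← Real.rpow_mul (by positivity),
    mul_one_div_cancel hα.ne', Real.rpow_one, inv_div]

theorem tendsto_mul_log_domain {α : ℝ} {d : ℕ → ℕ} (hα : 0 < α)
    (hd : ∀ n : ℕ, |(d n : ℝ) - (n : ℝ) ^ α| < 1) :
    Tendsto (fun n : ℕ => (n : ℝ) * Real.log (d n)) atTop atTop :=
  tendsto_natCast_atTop_atTop.atTop_mul_atTop₀
    (Real.tendsto_log_atTop.comp (tendsto_domain_atTop hα hd))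

/-- The factor in front of `C(s,k) / C(n,k) - 1 / d ^ k` in the second moment ratio tends to
`p / (1 - p)`. -/
theorem tendsto_coupling {N q : ℕ → ℝ} {p : ℝ} (hp1 : p < 1) (hN : Tendsto N atTop atTop)
    (hq : Tendsto (fun n => q n / N n) atTop (𝓝 p)) :
    Tendsto (fun n => N n * q n / ((N n - q n) * (N n - 1))) atTop (𝓝 (p / (1 - p))) := by
  have h0 : Tendsto (fun n => (N n)⁻¹) atTop (𝓝 0) := hN.inv_tendsto_atTop
  have h := hq.div ((hq.const_sub 1).mul (h0.const_sub 1)) (by simp; linarith)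
  rw [sub_zero, mul_one] at h
  refine h.congr' ?_
  filter_upwards [hN.eventually_gt_atTop 0] with n hn
  have e : N n * q n / ((N n - q n) * (N n - 1)) =
      (N n * N n * (q n / N n)) / (N n * N n * ((1 - q n / N n) * (1 - (N n)⁻¹))) := by
    congr 1 <;> field_simp
  rw [e, mul_div_mul_left _ _ (by positivity)]
  rfl

/-! ### The two regimes -/

theorem tendsto_rbProbSat_zero {k : ℕ} {α p r : ℝ} (hk : 1 ≤ k) (hα : 0 < α) (hp1 : p < 1)
    {d q t : ℕ → ℕ} (hd : ∀ n : ℕ, |(d n : ℝ) - (n : ℝ) ^ α| < 1)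
    (hq : ∀ n : ℕ, |(q n : ℝ) - p * (d n : ℝ) ^ k| < 1)
    (ht : ∀ n : ℕ, |(t n : ℝ) - r * (n : ℝ) * Real.log (d n)| < 1)
    (hr : r * Real.log (1 - p) < -1) :
    Tendsto (fun n : ℕ => rbProbSat n (d n) k (q n) (t n)) atTop (𝓝 0) := by
  have hdt := tendsto_domain_atTop hα hd
  have hNt : Tendsto (fun n => (d n : ℝ) ^ k) atTop atTop :=
    (tendsto_pow_atTop (by omega)).comp hdt
  have hqN := tendsto_div_of_abs_sub_lt_one hNt (fun n => rfl) hq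
  have hnl := tendsto_mul_log_domain hα hd
  have htn := tendsto_div_of_abs_sub_lt_one hnl (fun n => mul_assoc r _ _) ht
  have hlog := (hqN.const_sub 1).log (by linarith : 1 - p ≠ 0)
  have hneg : Tendsto (fun n : ℕ => ((n : ℝ) * Real.log (d n)) *
      (1 + (t n : ℝ) / (n * Real.log (d n)) * Real.log (1 - q n / (d n : ℝ) ^ k)))
      atTop atBot :=
    hnl.atTop_mul_neg (by linarith : 1 + r * Real.log (1 - p) < 0)
      ((htn.mul hlog).const_add 1)
  refine squeeze_zero' (Eventually.of_forall fun n => rbProbSat_nonneg _ _ _ _ _) ?_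
    (Real.tendsto_exp_atBot.comp hneg)
  filter_upwards [eventually_ge_atTop k, hdt.eventually_gt_atTop 0,
    hqN.eventually_lt_const hp1, hnl.eventually_gt_atTop 0] with n hkn hd0 hq1 hnl0
  have hN0 : 0 < (d n : ℝ) ^ k := by positivity
  have hqN' : (q n : ℝ) < (d n : ℝ) ^ k := by rwa [div_lt_one hN0] at hq1
  refine (rbProbSat_le (t n) hkn (by exact_mod_cast hd0)
    (by exact_mod_cast hqN'.le)).trans_eq ?_
  have hpos : 0 < 1 - (q n : ℝ) / (d n : ℝ) ^ k := by linarith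
  rw [sub_div, div_self hN0.ne', Function.comp_apply]
  have e : ∀ u v y : ℝ, u ≠ 0 → u * (1 + v / u * y) = u + v * y := by
    intro u v y hu
    field_simp
  rw [e _ _ _ hnl0.ne', Real.exp_add, Real.exp_nat_mul,
    Real.exp_nat_mul, Real.exp_log hd0, Real.exp_log hpos]

theorem tendsto_momentRatio_le {k : ℕ} {α p r L : ℝ} (hk : 2 ≤ k) (hα : 0 < α) (hp0 : 0 < p)
    (hp1 : p < 1) {d q t : ℕ → ℕ} (hd : ∀ n : ℕ, |(d n : ℝ) - (n : ℝ) ^ α| < 1)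
    (hq : ∀ n : ℕ, |(q n : ℝ) - p * (d n : ℝ) ^ k| < 1)
    (ht : ∀ n : ℕ, |(t n : ℝ) - r * (n : ℝ) * Real.log (d n)| < 1)
    (hkα : 1 < (2 * (k : ℝ) - 1) * α) (hL : 0 < L) (hLp : Real.exp L - 1 = p / (1 - p))
    (hLk : L * Real.exp L ≤ k * (Real.exp L - 1)) (hr0 : 0 < r) (hr : r * L < 1) {η : ℝ}
    (hη : 0 < η) :
    ∀ᶠ n in atTop, momentRatio n (d n) k (q n) (t n) < 1 + 2 * η := by
  have hk2 : (2 : ℝ) ≤ k := by exact_mod_cast hk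
  obtain ⟨δ, hδ0, hδr, hδα⟩ : ∃ δ : ℝ, 0 < δ ∧ r * L < 1 - 2 * δ ∧
      0 < 2 * ((1 - δ) * ((k : ℝ) - 1)) + 1 - 1 / α := by
    have hα' : 0 < 2 * (k : ℝ) - 1 - 1 / α := by
      rw [sub_pos, div_lt_iff₀ hα]
      exact hkα
    have h1 : 0 < (1 - r * L) / 2 := by linarith
    have h2 : 0 < (2 * (k : ℝ) - 1 - 1 / α) / (2 * k) := by positivity
    obtain ⟨δ, h0, hlt⟩ := exists_between (lt_min h1 h2)
    have h3 := (lt_min_iff.1 hlt).1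
    have h4 := (lt_min_iff.1 hlt).2
    rw [lt_div_iff₀ (by positivity)] at h4
    exact ⟨δ, h0, by linarith, by nlinarith⟩
  have hδ1 : δ < 1 := by nlinarith [mul_pos hr0 hL]
  have hdt := tendsto_domain_atTop hα hd
  have hNt : Tendsto (fun n => (d n : ℝ) ^ k) atTop atTop :=
    (tendsto_pow_atTop (by omega)).comp hdt
  have hqN := tendsto_div_of_abs_sub_lt_one hNt (fun n => rfl) hq
  have hnl := tendsto_mul_log_domain hα hd
  have htn := tendsto_div_of_abs_sub_lt_one hnl (fun n => mul_assoc r _ _) ht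
  have hC := tendsto_coupling hp1 hNt hqN
  set C : ℕ → ℝ := fun n => (d n : ℝ) ^ k * q n / (((d n : ℝ) ^ k - q n) * ((d n : ℝ) ^ k - 1))
    with hCdef
  have hc : 0 < Real.exp L - 1 := by
    rw [hLp]
    exact div_pos hp0 (by linarith)
  set R : ℕ → ℝ := fun n => (t n : ℝ) / (n * Real.log (d n)) with hR
  set w : ℕ → ℝ := fun n => (d n : ℝ) ^ (-δ) with hwdef
  have hw : Tendsto w atTop (𝓝 0) := (tendsto_rpow_neg_atTop hδ0).comp hdt
  have hlogw : Tendsto (fun n => Real.log (d n) * w n) atTop (𝓝 0) :=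
    (tendsto_log_mul_rpow_neg hδ0).comp hdt
  set m : ℕ → ℝ := fun n => max 1 (C n / (Real.exp L - 1)) with hm
  have hmt : Tendsto m atTop (𝓝 1) := by
    have := (tendsto_const_nhds (x := (1 : ℝ))).max (hC.div_const (Real.exp L - 1))
    rwa [← hLp, div_self hc.ne', max_self] at this
  -- the slope `θ` of the linearised exponent
  set θ : ℕ → ℝ := fun n => t n * C n * k * (1 / (d n * w n)) ^ (k - 1) / n with hθdef
  have hθ_eq : ∀ᶠ n in atTop, θ n =
      R n * C n * k * (Real.log (d n) * (d n : ℝ) ^ (-((1 - δ) * ((k : ℝ) - 1)))) := by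
    filter_upwards [hnl.eventually_gt_atTop 0, hdt.eventually_gt_atTop 0] with n hn hd0
    have hz : (1 / ((d n : ℝ) * w n)) ^ (k - 1) = (d n : ℝ) ^ (-((1 - δ) * ((k : ℝ) - 1))) := by
      have e1 : (d n : ℝ) * w n = (d n : ℝ) ^ (1 - δ) := by
        rw [hwdef, sub_eq_add_neg, Real.rpow_add hd0, Real.rpow_one]
      rw [e1, one_div, ← Real.rpow_neg hd0.le, ← Real.rpow_mul_natCast hd0.le,
        Nat.cast_sub (by omega)]
      congr 1
      push_cast
      ring
    have hn0 : (n : ℝ) ≠ 0 := by rintro h; simp [h] at hn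
    have hl0 : Real.log (d n) ≠ 0 := by rintro h; simp [h] at hn
    simp only [hθdef, hR]
    rw [hz]
    field_simp
  have hRCk : Tendsto (fun n => R n * C n * k) atTop (𝓝 (r * (p / (1 - p)) * k)) :=
    (htn.mul hC).mul_const _
  have hθ : Tendsto θ atTop (𝓝 0) := by
    have hβ : 0 < (1 - δ) * ((k : ℝ) - 1) := mul_pos (by linarith) (by linarith)
    have := hRCk.mul ((tendsto_log_mul_rpow_neg hβ).comp hdt)
    rw [mul_zero] at this
    refine this.congr' ?_
    filter_upwards [hθ_eq] with n hn
    rw [hn]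
    rfl
  -- `(2k - 1) α > 1` makes `θ` small compared with the inverse standard deviation `(d / n) ^ (1/2)`
  have hvar : Tendsto (fun n : ℕ => 4 * θ n ^ 2 * n * (1 / d n)) atTop (𝓝 0) := by
    set β : ℝ := 2 * ((1 - δ) * ((k : ℝ) - 1)) + 1 - 1 / α with hβ
    have h1 := ((((tendsto_log_mul_rpow_neg (half_pos hδα)).comp hdt).pow 2).mul
      (tendsto_natCast_div_domain_rpow hα hd)).mul ((hRCk.pow 2).const_mul 4)
    rw [zero_pow two_ne_zero, zero_mul, zero_mul] at h1
    refine h1.congr' ?_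
    filter_upwards [hθ_eq, hdt.eventually_gt_atTop 0] with n hn hd0
    rw [hn]
    simp only [Function.comp_apply]
    have e : ((d n : ℝ) ^ (-(β / 2))) ^ 2 / (d n : ℝ) ^ (1 / α) =
        ((d n : ℝ) ^ (-((1 - δ) * ((k : ℝ) - 1)))) ^ 2 * (1 / d n) := by
      rw [← Real.rpow_mul_natCast hd0.le, ← Real.rpow_mul_natCast hd0.le, ← Real.rpow_sub hd0,
        one_div (d n : ℝ), ← Real.rpow_neg_one, ← Real.rpow_add hd0]
      congr 1
      rw [hβ]
      push_cast
      ring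
    calc _ = 4 * (R n * C n * k) ^ 2 * Real.log (d n) ^ 2 * n *
        (((d n : ℝ) ^ (-(β / 2))) ^ 2 / (d n : ℝ) ^ (1 / α)) := by ring
      _ = _ := by rw [e]; ring
  have hmid : ∀ᶠ n in atTop, R n * C n * (Real.log (d n) * w n) < 1 := by
    have := (htn.mul hC).mul hlogw
    rw [mul_zero] at this
    exact this.eventually_lt_const one_pos
  have hhigh : ∀ᶠ n in atTop, m n * R n * L < 1 - 2 * δ := by
    have := (hmt.mul htn).mul_const L
    rw [one_mul] at this
    exact this.eventually_lt_const hδr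
  have hCN : ∀ᶠ n in atTop, C n < (d n : ℝ) ^ k := by
    filter_upwards [hC.eventually_lt_const (lt_add_one _), hNt.eventually_gt_atTop _] with n h1 h2
    exact h1.trans h2
  have hlim : Tendsto (fun n : ℕ => 1 + η + (Real.exp (4 * θ n ^ 2 * n * (1 / d n)) - 1) / (4 * η) +
      2 * (Real.exp 2 * w n)) atTop (𝓝 (1 + η)) := by
    have h1 := (((Real.continuous_exp.tendsto _).comp hvar).sub_const 1).div_const (4 * η)
    have h2 := (h1.const_add (1 + η)).add ((hw.const_mul (Real.exp 2)).const_mul 2)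
    simpa using h2
  filter_upwards [eventually_ge_atTop k, hdt.eventually_ge_atTop 1, hNt.eventually_ge_atTop 2,
    hqN.eventually_lt_const hp1, hnl.eventually_gt_atTop 0, hmid, hhigh, hCN,
    hθ.eventually_le_const (by norm_num : (0 : ℝ) < 1 / 2),
    hlim.eventually_lt_const (by linarith : 1 + η < 1 + 2 * η),
    (hw.const_mul (Real.exp 2)).eventually_le_const (by norm_num : Real.exp 2 * 0 < 1 / 2)]
    with n hkn hd1 hN2 hq1 hnl0 hmid hhigh hCN hθ2 hlim hw2
  have hd0 : (0 : ℝ) < d n := by linarith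
  have hN0 : 0 < (d n : ℝ) ^ k := by positivity
  have hqN' : (q n : ℝ) < (d n : ℝ) ^ k := by rwa [div_lt_one hN0] at hq1
  have hn0 : (0 : ℝ) < n := by exact_mod_cast (by omega : 0 < n)
  have hl0 : 0 < Real.log (d n) := pos_of_mul_pos_right hnl0 hn0.le
  refine lt_of_le_of_lt (momentRatio_le (C := C n) (w := w n) (m := m n) (L := L) (θ := θ n)
    (by omega) hk hkn (by exact_mod_cast hd1) (by exact_mod_cast hN2) (by exact_mod_cast hqN')
    rfl hCN.le (Real.rpow_pos_of_pos hd0 _) hw2 hL hLk (le_max_left _ _) ?_ ?_ ?_ rfl hθ2 hη) hlim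
  · rw [← div_le_iff₀ hc]
    exact le_max_right _ _
  · have e : (t n : ℝ) * C n * w n = n * (R n * C n * (Real.log (d n) * w n)) := by
      simp only [hR]
      field_simp
    rw [e]
    exact mul_le_of_le_one_right hn0.le hmid.le
  · have e1 : m n * t n * L / n = (m n * R n * L) * Real.log (d n) := by
      simp only [hR]
      field_simp
    have e2 : (d n : ℝ) * w n ^ 2 = Real.exp ((1 - 2 * δ) * Real.log (d n)) := by
      rw [hwdef, ← Real.rpow_mul_natCast hd0.le, mul_comm, ← Real.rpow_add_one hd0.ne',
        Real.rpow_def_of_pos hd0, mul_comm]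
      congr 2
      push_cast
      ring
    rw [e1, e2]
    exact Real.exp_le_exp.2 (mul_le_mul_of_nonneg_right hhigh.le hl0.le)

theorem tendsto_rbProbSat_one {k : ℕ} {α p r L : ℝ} (hk : 2 ≤ k) (hα : 0 < α) (hp0 : 0 < p)
    (hp1 : p < 1) {d q t : ℕ → ℕ} (hd : ∀ n : ℕ, |(d n : ℝ) - (n : ℝ) ^ α| < 1)
    (hq : ∀ n : ℕ, |(q n : ℝ) - p * (d n : ℝ) ^ k| < 1)
    (ht : ∀ n : ℕ, |(t n : ℝ) - r * (n : ℝ) * Real.log (d n)| < 1)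
    (hkα : 1 < (2 * (k : ℝ) - 1) * α) (hL : 0 < L) (hLp : Real.exp L - 1 = p / (1 - p))
    (hLk : L * Real.exp L ≤ k * (Real.exp L - 1)) (hr0 : 0 < r) (hr : r * L < 1) :
    Tendsto (fun n : ℕ => rbProbSat n (d n) k (q n) (t n)) atTop (𝓝 1) := by
  have hdt := tendsto_domain_atTop hα hd
  have hNt : Tendsto (fun n => (d n : ℝ) ^ k) atTop atTop :=
    (tendsto_pow_atTop (by omega)).comp hdt
  have hqN := tendsto_div_of_abs_sub_lt_one hNt (fun n => rfl) hq
  have hPM : ∀ᶠ n in atTop,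
      1 ≤ rbProbSat n (d n) k (q n) (t n) * momentRatio n (d n) k (q n) (t n) := by
    filter_upwards [eventually_ge_atTop k, hdt.eventually_ge_atTop 1, hNt.eventually_ge_atTop 2,
      hqN.eventually_lt_const hp1] with n hkn hd1 hN2 hq1
    rw [div_lt_one (by linarith)] at hq1
    exact one_le_rbProbSat_mul_momentRatio (t n) hkn (by exact_mod_cast hd1)
      (by exact_mod_cast hN2) (by exact_mod_cast hq1)
  rw [tendsto_order]
  refine ⟨fun a ha => ?_, fun a ha => Eventually.of_forall fun n =>
    (rbProbSat_le_one _ _ _ _ _).trans_lt ha⟩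
  -- `η` is chosen so that `a * (1 + 2 * η) ≤ 1`
  have hη : 0 < (1 - a) / (2 * (1 + |a|)) := div_pos (by linarith) (by positivity)
  filter_upwards [hPM, tendsto_momentRatio_le hk hα hp0 hp1 hd hq ht hkα hL hLp hLk hr0 hr hη]
    with n h1 h2
  have hP0 := rbProbSat_nonneg n (d n) k (q n) (t n)
  by_contra! hle
  have hη' : 2 * ((1 - a) / (2 * (1 + |a|))) * (1 + |a|) = 1 - a := by field_simp
  set η := (1 - a) / (2 * (1 + |a|))
  have h3 : rbProbSat n (d n) k (q n) (t n) * momentRatio n (d n) k (q n) (t n) ≤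
      rbProbSat n (d n) k (q n) (t n) * (1 + 2 * η) := mul_le_mul_of_nonneg_left h2.le hP0
  have h4 : rbProbSat n (d n) k (q n) (t n) * (1 + 2 * η) ≤ a * (1 + 2 * η) :=
    mul_le_mul_of_nonneg_right hle (by linarith)
  have h5 : 2 * η * a ≤ 2 * η * |a| := mul_le_mul_of_nonneg_left (le_abs_self a) (by linarith)
  linarith

theorem theorem3p1 (k : ℕ) (hk : 2 ≤ k) (α p r τ r_cr : ℝ)
    (hα : 0 < α) (hp0 : 0 < p) (hp1 : p < 1) (hr : 0 < r)
    (hτ : τ = 1 / (1 - p)) (hr_cr : r_cr = 1 / Real.log τ)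
    (hkα : 1 < (2 * (k : ℝ) - 1) * α)
    (hkτ : τ * Real.log τ / (τ - 1) ≤ (k : ℝ))
    -- domain size, number of incompatible tuples and number of constraints,
    -- each rounded to an integer in an arbitrary way
    (d q t : ℕ → ℕ)
    (hd : ∀ n : ℕ, |(d n : ℝ) - (n : ℝ) ^ α| < 1)
    (hq : ∀ n : ℕ, |(q n : ℝ) - p * (d n : ℝ) ^ k| < 1)
    (ht : ∀ n : ℕ, |(t n : ℝ) - r * (n : ℝ) * Real.log (d n)| < 1) :
    (r < r_cr → Tendsto (fun n : ℕ => rbProbSat n (d n) k (q n) (t n)) atTop (𝓝 1)) ∧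
    (r_cr < r → Tendsto (fun n : ℕ => rbProbSat n (d n) k (q n) (t n)) atTop (𝓝 0)) := by
  have hp : 0 < 1 - p := by linarith
  have hτ0 : 0 < τ := by rw [hτ]; positivity
  have hτ1 : 1 < τ := by rw [hτ, lt_div_iff₀ hp]; linarith
  have hL : 0 < Real.log τ := Real.log_pos hτ1
  have hlog : Real.log (1 - p) = -Real.log τ := by
    rw [hτ, one_div, Real.log_inv, neg_neg]
  constructor
  · intro h
    rw [hr_cr, lt_div_iff₀ hL] at h
    refine tendsto_rbProbSat_one hk hα hp0 hp1 hd hq ht hkα hL ?_ ?_ hr h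
    · rw [Real.exp_log hτ0, hτ]
      field_simp
      ring
    · rw [div_le_iff₀ (by linarith)] at hkτ
      rwa [Real.exp_log hτ0, mul_comm]
  · intro h
    rw [hr_cr, div_lt_iff₀ hL] at h
    refine tendsto_rbProbSat_zero (by omega) hα hp1 hd hq ht ?_
    rw [hlog]
    linarith
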